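/- Let $n\ge 2$, let $\mathbb R^n$ carry the Euclidean norm, and let $B(x,r)$ denote the closed ball of radius $r$ centred at $x$. For $A\subset\mathbb R^n$ let $A^c=\bigcap_{x\in A}B(x,1)$ (with $\emptyset^c=\mathbb R^n$), let ${\rm conv}_c(A)=(A^c)^c$ be its $c$-hull, and let ${\rm Outrad}(A)=\inf\{R\ge 0:\ A\subseteq B(x,R)\text{ for some }x\in\mathbb R^n\}\in[0,\infty]$ be its out-radius. A point $x\in K={\rm conv}_c(A)$ is called $c$-extremal for $K$ if, whenever $y,z\in K$ and $x\in{\rm conv}_c(\{y,z\})$, one has $y=x$ or $z=x$; the set of such points is denoted ${\rm ext}_c(K)$. Let $A\subset\mathbb R^n$ be closed with ${\rm Outrad}(A)<1$. Then: 1. for every $x\in{\rm conv}_c(A)$ there are $m\le n+1$ and points $x_1,\dots,x_m\in A$ such that $x\in{\rm conv}_c(\{x_1,\dots,x_m\})$; 2. (an equivalent form) every $c$-extremal point of ${\rm conv}_c(A)$ belongs to $A$, that is, ${\rm ext}_c({\rm conv}_c(A))\subseteq A$. -/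

import Mathlib

open scoped NNReal ENNReal

namespace BallBody

/-- The `c`-dual `A^c` of a set `A ⊆ ℝⁿ`: the intersection of the closed Euclidean unit balls
centred at the points of `A` (all of `ℝⁿ` if `A` is empty). -/
def cDual {n : ℕ} (A : Set (EuclideanSpace ℝ (Fin n))) : Set (EuclideanSpace ℝ (Fin n)) :=
  ⋂ x ∈ A, Metric.closedBall x 1

/-- The `c`-hull `conv_c(A) = A^{cc}`. -/
def cHull {n : ℕ} (A : Set (EuclideanSpace ℝ (Fin n))) : Set (EuclideanSpace ℝ (Fin n)) :=
  cDual (cDual A)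

/-- The out-radius of `A`: the least (infimal) `R ≥ 0` for which `A` lies in a closed ball of
radius `R`. It takes values in `[0, ∞]`, and equals `∞` if `A` is unbounded. -/
noncomputable def outrad {n : ℕ} (A : Set (EuclideanSpace ℝ (Fin n))) : ℝ≥0∞ :=
  ⨅ (R : ℝ≥0) (_ : ∃ x, A ⊆ Metric.closedBall x (R : ℝ)), (R : ℝ≥0∞)

/-- The set `ext_c(K)` of `c`-extremal points of `K`. -/
def cExt {n : ℕ} (K : Set (EuclideanSpace ℝ (Fin n))) : Set (EuclideanSpace ℝ (Fin n)) :=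
  {x | x ∈ K ∧ ∀ y ∈ K, ∀ z ∈ K, x ∈ cHull {y, z} → y = x ∨ z = x}

end BallBody

open scoped InnerProductSpace

/-! A point `x` of the hull either is interior or satisfies `‖x - y‖ = 1` for some `y` in the dual.
In the second case `u = x - y` lies in the cone of the contact vectors, the unit vectors from `y` to
`A`: otherwise a separating direction moves `y` inside the dual and away from `x`. Carathéodory,
with out-radius below 1 excluding a degenerate relation, needs only `n` of them
(`exists_finset_sum_contactVectors`). Conversely, unit vectors in such a cone stay in the hull
(`add_mem_cHull_of_sum_eq`).

For an arbitrary `x`, the ray from some `a ∈ A` through `x` is followed to a touching point, and `a`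
is the extra point. An extremal point is not interior, and splitting its conic combination into two
unit directions forces `u` to be a contact vector. -/

/-! ### Compact convex hulls and separation -/

theorem IsCompact.convexHull_of_finiteDimensional {E : Type*} [NormedAddCommGroup E]
    [NormedSpace ℝ E] [FiniteDimensional ℝ E] {s : Set E} (hs : IsCompact s) :
    IsCompact (convexHull ℝ s) := by
  -- Carathéodory bounds the number of points, so the hull is a finite union of continuous images of
  -- compact sets.
  have key : convexHull ℝ s = ⋃ m ∈ Set.Iic (Module.finrank ℝ E + 1),
      (fun q : (Fin m → ℝ) × (Fin m → E) => ∑ i, q.1 i • q.2 i) ''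
        (stdSimplex ℝ (Fin m) ×ˢ Set.univ.pi fun _ => s) := by
    apply Set.Subset.antisymm
    · intro x hx
      obtain ⟨ι, _, z, w, hz, hind, hw, hw1, hx⟩ := eq_pos_convex_span_of_mem_convexHull hx
      have hcard : Fintype.card ι ≤ Module.finrank ℝ E + 1 :=
        hind.card_le_finrank_succ.trans (by gcongr; exact Submodule.finrank_le _)
      let e := (Fintype.equivFin ι).symm
      refine Set.mem_biUnion (x := Fintype.card ι) hcard
        ⟨(w ∘ e, z ∘ e), ⟨⟨fun i => (hw _).le, ?_⟩, fun i _ => hz ⟨_, rfl⟩⟩, ?_⟩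
      · rw [← hw1]
        exact e.sum_comp w
      · rw [← hx]
        exact e.sum_comp fun i => w i • z i
    · refine Set.iUnion₂_subset fun m _ => ?_
      rintro _ ⟨⟨w, z⟩, ⟨⟨hw, hw1⟩, hz⟩, rfl⟩
      exact (convex_convexHull ℝ s).sum_mem (fun i _ => hw i) hw1
        fun i _ => subset_convexHull ℝ s (hz i trivial)
  rw [key]
  refine (Set.finite_Iic _).isCompact_biUnion fun m _ => ?_
  refine IsCompact.image (IsCompact.prod (isCompact_stdSimplex ℝ _)
    (isCompact_univ_pi fun _ => hs)) ?_
  fun_prop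

/-- If no point of the convex hull of a compact set vanishes, some vector has positive inner
product with all points of the set. -/
theorem IsCompact.exists_forall_inner_pos {E : Type*} [NormedAddCommGroup E]
    [InnerProductSpace ℝ E] [FiniteDimensional ℝ E] {s : Set E} (hs : IsCompact s)
    (h0 : (0 : E) ∉ convexHull ℝ s) : ∃ v : E, ∀ a ∈ s, 0 < ⟪v, a⟫_ℝ := by
  obtain ⟨f, u, hf0, hf⟩ := geometric_hahn_banach_point_closed (convex_convexHull ℝ s)
    hs.convexHull_of_finiteDimensional.isClosed h0
  refine ⟨(InnerProductSpace.toDual ℝ E).symm f, fun a ha => ?_⟩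
  rw [InnerProductSpace.toDual_symm_apply]
  rw [map_zero] at hf0
  exact hf0.trans (hf a (subset_convexHull ℝ s ha))

namespace BallBody

/-! ### The `c`-duality -/

variable {n : ℕ} {A B : Set (EuclideanSpace ℝ (Fin n))} {x y c : EuclideanSpace ℝ (Fin n)}

theorem mem_cDual : y ∈ cDual A ↔ ∀ a ∈ A, ‖a - y‖ ≤ 1 := by
  simp [cDual, dist_eq_norm, norm_sub_rev]

theorem mem_cHull : x ∈ cHull A ↔ ∀ y ∈ cDual A, ‖x - y‖ ≤ 1 := by
  rw [cHull, mem_cDual]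
  simp only [norm_sub_rev]

theorem cDual_anti (h : A ⊆ B) : cDual B ⊆ cDual A :=
  Set.biInter_subset_biInter_left h

theorem subset_cHull : A ⊆ cHull A := fun _ ha => mem_cHull.2 fun _ hy => mem_cDual.1 hy _ ha

theorem cHull_mono (h : A ⊆ B) : cHull A ⊆ cHull B := cDual_anti (cDual_anti h)

theorem cHull_subset (h : A ⊆ cHull B) : cHull A ⊆ cHull B := fun _ hx =>
  mem_cHull.2 fun _ hy => mem_cHull.1 hx _ (mem_cDual.2 fun _ ha => mem_cHull.1 (h ha) _ hy)

theorem isClosed_cDual : IsClosed (cDual A) :=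
  isClosed_biInter fun _ _ => Metric.isClosed_closedBall

theorem convex_cDual : Convex ℝ (cDual A) :=
  convex_iInter₂ fun _ _ => convex_closedBall _ _

theorem isCompact_cDual (hA : A.Nonempty) : IsCompact (cDual A) := by
  obtain ⟨a, ha⟩ := hA
  exact (isCompact_closedBall a 1).of_isClosed_subset isClosed_cDual (Set.biInter_subset_of_mem ha)

theorem exists_center_of_outrad_lt_one (h : outrad A < 1) :
    ∃ c : EuclideanSpace ℝ (Fin n), ∃ R : ℝ, 0 ≤ R ∧ R < 1 ∧ ∀ a ∈ A, ‖a - c‖ ≤ R := by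
  simp only [outrad, iInf_lt_iff] at h
  obtain ⟨R, ⟨c, hc⟩, hR⟩ := h
  exact ⟨c, R, R.2, by exact_mod_cast hR, fun a ha => by simpa [dist_eq_norm] using hc ha⟩

/-- A point of the `c`-hull is either interior or on the unit sphere about a point of the dual. -/
theorem exists_norm_eq_one_or_closedBall_subset (hA : A.Nonempty) (hA' : (cDual A).Nonempty)
    (hx : x ∈ cHull A) : (∃ y ∈ cDual A, ‖x - y‖ = 1) ∨
      ∃ δ > 0, Metric.closedBall x δ ⊆ cHull A := by
  obtain ⟨y, hy, hmax⟩ := (isCompact_cDual hA).exists_isMaxOn hA'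
    (f := fun y => ‖x - y‖) (by fun_prop)
  rcases (mem_cHull.1 hx y hy).eq_or_lt with h | h
  · exact Or.inl ⟨y, hy, h⟩
  · refine Or.inr ⟨1 - ‖x - y‖, by linarith, fun z hz => mem_cHull.2 fun w hw => ?_⟩
    have h1 : ‖x - w‖ ≤ ‖x - y‖ := hmax hw
    have h2 := norm_sub_le_norm_sub_add_norm_sub z x w
    rw [Metric.mem_closedBall, dist_eq_norm] at hz
    linarith

/-! ### Contact vectors and touching points -/

/-- A unit vector which is a nonnegative combination of unit vectors `v ∈ F` lies in the
`c`-hull of `F` (all based at `y`). -/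
theorem add_mem_cHull_of_sum_eq {F : Finset (EuclideanSpace ℝ (Fin n))}
    {w : EuclideanSpace ℝ (Fin n) → ℝ} {u : EuclideanSpace ℝ (Fin n)} (hF : ∀ v ∈ F, ‖v‖ = 1)
    (hw : ∀ v ∈ F, 0 ≤ w v) (hu : ‖u‖ = 1) (hsum : ∑ v ∈ F, w v • v = u) :
    y + u ∈ cHull ((fun v => y + v) '' (F : Set (EuclideanSpace ℝ (Fin n)))) := by
  refine mem_cHull.2 fun z hz => ?_
  set d := z - y with hd
  have h1 : 1 ≤ ∑ v ∈ F, w v := by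
    calc 1 = ‖∑ v ∈ F, w v • v‖ := by rw [hsum, hu]
      _ ≤ ∑ v ∈ F, ‖w v • v‖ := norm_sum_le _ _
      _ = ∑ v ∈ F, w v := Finset.sum_congr rfl fun v hv => by
        rw [norm_smul, hF v hv, mul_one, Real.norm_of_nonneg (hw v hv)]
  -- For unit `v`, `‖v - d‖ ≤ 1` means `‖d‖² ≤ 2⟪v, d⟫`, which is linear in `v`; it survives the
  -- weighted sum because the total weight is at least 1.
  have h2 : ∀ v ∈ F, ‖d‖ ^ 2 ≤ 2 * ⟪v, d⟫_ℝ := fun v hv => by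
    have h := mem_cDual.1 hz (y + v) ⟨v, hv, rfl⟩
    rw [show y + v - z = v - d by rw [hd]; abel] at h
    have h' := norm_sub_sq_real v d
    rw [hF v hv] at h'
    nlinarith [norm_nonneg (v - d)]
  have h3 : ‖d‖ ^ 2 ≤ 2 * ⟪u, d⟫_ℝ := by
    calc ‖d‖ ^ 2 ≤ (∑ v ∈ F, w v) * ‖d‖ ^ 2 := le_mul_of_one_le_left (sq_nonneg _) h1
      _ = ∑ v ∈ F, w v * ‖d‖ ^ 2 := Finset.sum_mul ..
      _ ≤ ∑ v ∈ F, w v * (2 * ⟪v, d⟫_ℝ) :=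
        Finset.sum_le_sum fun v hv => mul_le_mul_of_nonneg_left (h2 v hv) (hw v hv)
      _ = 2 * ⟪u, d⟫_ℝ := by
        rw [← hsum, sum_inner, Finset.mul_sum]
        exact Finset.sum_congr rfl fun v _ => by rw [real_inner_smul_left]; ring
  rw [show y + u - z = u - d by rw [hd]; abel]
  have h' := norm_sub_sq_real u d
  rw [hu] at h'
  nlinarith [norm_nonneg (u - d)]

/-- The unit vectors pointing from `y` to `A`. -/
def contactVectors (A : Set (EuclideanSpace ℝ (Fin n))) (y : EuclideanSpace ℝ (Fin n)) :
    Set (EuclideanSpace ℝ (Fin n)) :=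
  {v | ‖v‖ = 1 ∧ y + v ∈ A}

theorem isCompact_contactVectors (hA : IsClosed A) : IsCompact (contactVectors A y) := by
  refine (isCompact_sphere (0 : EuclideanSpace ℝ (Fin n)) 1).of_isClosed_subset ?_
    fun v hv => by simpa using hv.1
  exact (isClosed_eq continuous_norm continuous_const).inter (hA.preimage (by fun_prop))

/-- If `v` has positive inner product with all contact vectors at `y`, then `y` can be moved
slightly in direction `v` within the dual. -/
theorem eventually_add_smul_mem_cDual (hA : IsCompact A) (hy : y ∈ cDual A)
    {v : EuclideanSpace ℝ (Fin n)} (hv : ∀ u ∈ contactVectors A y, 0 < ⟪v, u⟫_ℝ) :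
    ∀ᶠ t in nhdsWithin (0 : ℝ) (Set.Ioi 0), y + t • v ∈ cDual A := by
  -- The bound is local in the point of `A` and in `t` jointly; compactness of `A` then gives a
  -- common range of `t`.
  have key : ∀ a ∈ A, ∀ᶠ q : EuclideanSpace ℝ (Fin n) × ℝ in
      nhdsWithin a A ×ˢ nhdsWithin (0 : ℝ) (Set.Ioi 0), ‖q.1 - (y + q.2 • v)‖ ≤ 1 := by
    intro a ha
    have hle : nhdsWithin a A ×ˢ nhdsWithin (0 : ℝ) (Set.Ioi 0) ≤ nhds (a, (0 : ℝ)) := by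
      rw [nhds_prod_eq]
      exact Filter.prod_mono nhdsWithin_le_nhds nhdsWithin_le_nhds
    rcases (mem_cDual.1 hy a ha).eq_or_lt with h | h
    · have hpos : 0 < ⟪v, a - y⟫_ℝ := hv _ ⟨h, by simpa using ha⟩
      have hc : ContinuousAt (fun q : EuclideanSpace ℝ (Fin n) × ℝ =>
          2 * ⟪v, q.1 - y⟫_ℝ - q.2 * ‖v‖ ^ 2) (a, 0) := by fun_prop
      have h1 := hle (hc.eventually_const_lt (u := 0) (by simpa using hpos))
      have h2 : ∀ᶠ q : EuclideanSpace ℝ (Fin n) × ℝ in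
          nhdsWithin a A ×ˢ nhdsWithin (0 : ℝ) (Set.Ioi 0), q.1 ∈ A ∧ 0 < q.2 :=
        Filter.prod_mem_prod self_mem_nhdsWithin self_mem_nhdsWithin
      filter_upwards [h1, h2] with q hq1 hq2
      have h3 := mem_cDual.1 hy q.1 hq2.1
      have h4 := norm_sub_sq_real (q.1 - y) (q.2 • v)
      rw [real_inner_smul_right, real_inner_comm, norm_smul, mul_pow, Real.norm_eq_abs,
        sq_abs] at h4
      rw [← sub_sub]
      replace hq1 : 0 < 2 * ⟪v, q.1 - y⟫_ℝ - q.2 * ‖v‖ ^ 2 := hq1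
      nlinarith [norm_nonneg (q.1 - y - q.2 • v), norm_nonneg (q.1 - y), mul_pos hq2.2 hq1]
    · have hc : ContinuousAt (fun q : EuclideanSpace ℝ (Fin n) × ℝ =>
          ‖q.1 - (y + q.2 • v)‖) (a, 0) := by fun_prop
      exact hle ((hc.eventually_lt_const (u := 1) (by simpa using h)).mono fun q hq => hq.le)
  have := hA.induction_on (p := fun s => ∀ᶠ t in nhdsWithin (0 : ℝ) (Set.Ioi 0),
    ∀ a ∈ s, ‖a - (y + t • v)‖ ≤ 1) (by simp)
    (fun s t hst ht => ht.mono fun r hr a ha => hr a (hst ha))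
    (fun s t hs ht => by
      filter_upwards [hs, ht] with r h1 h2 a ha
      exact ha.elim (h1 a) (h2 a))
    (fun a ha => by
      obtain ⟨p, hp, q, hq, h⟩ := Filter.eventually_prod_iff.1 (key a ha)
      exact ⟨{b | p b}, hp, hq.mono fun t ht b hb => h hb ht⟩)
  exact this.mono fun t ht => mem_cDual.2 ht

/-- At a boundary point of the `c`-hull, the direction from a touching centre is a nonnegative
combination of at most `n` contact vectors. -/
theorem exists_finset_sum_contactVectors (hA : IsClosed A) {R : ℝ} (hR0 : 0 ≤ R) (hR : R < 1)
    (hc : ∀ a ∈ A, ‖a - c‖ ≤ R) (hx : x ∈ cHull A) (hy : y ∈ cDual A) (hxy : ‖x - y‖ = 1) :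
    ∃ (F : Finset (EuclideanSpace ℝ (Fin n))) (w : EuclideanSpace ℝ (Fin n) → ℝ),
      ↑F ⊆ contactVectors A y ∧ F.card ≤ n ∧ (∀ v ∈ F, 0 ≤ w v) ∧
        ∑ v ∈ F, w v • v = x - y := by
  classical
  set u := x - y with hu
  have hA' : IsCompact A := (isCompact_closedBall c R).of_isClosed_subset hA
    fun a ha => by simpa [dist_eq_norm] using hc a ha
  -- `‖v - (c - y)‖ ≤ R < 1 = ‖v‖` puts all contact vectors in one open half-space.
  have hcpos : ∀ v ∈ contactVectors A y, 0 < ⟪v, c - y⟫_ℝ := fun v hv => by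
    have h1 := hc _ hv.2
    rw [show y + v - c = v - (c - y) by abel] at h1
    have h2 := norm_sub_sq_real v (c - y)
    rw [hv.1] at h2
    nlinarith [norm_nonneg (v - (c - y)), sq_nonneg ‖c - y‖]
  have h0 : (0 : EuclideanSpace ℝ (Fin n)) ∈ convexHull ℝ (insert (-u) (contactVectors A y)) := by
    by_contra h0
    obtain ⟨v, hv⟩ := ((isCompact_contactVectors hA).insert (-u)).exists_forall_inner_pos h0
    have hvu : ⟪v, u⟫_ℝ < 0 := by
      have := hv (-u) (Set.mem_insert _ _)
      rwa [inner_neg_right, neg_pos] at this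
    obtain ⟨t, ht, ht0⟩ := ((eventually_add_smul_mem_cDual hA' hy
      fun w hw => hv w (Set.mem_insert_of_mem _ hw)).and self_mem_nhdsWithin).exists
    replace ht0 : 0 < t := ht0
    have h1 := mem_cHull.1 hx _ ht
    rw [← sub_sub, ← hu] at h1
    have h2 := norm_sub_sq_real u (t • v)
    rw [real_inner_smul_right, real_inner_comm, hxy] at h2
    nlinarith [norm_nonneg (u - t • v), sq_nonneg ‖t • v‖, mul_neg_of_pos_of_neg ht0 hvu]
  rw [convexHull_eq_union] at h0
  simp only [Set.mem_iUnion] at h0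
  obtain ⟨T, hT, hind, h0⟩ := h0
  obtain ⟨w, hw, hw1, hsum⟩ := Finset.mem_convexHull'.1 h0
  have hcard : T.card ≤ n + 1 := by
    have := hind.card_le_finrank_succ.trans (Nat.succ_le_succ (Submodule.finrank_le _))
    simpa using this
  have hF : ∀ v ∈ T.erase (-u), v ∈ contactVectors A y := fun v hv =>
    ((Set.mem_insert_iff.1 (hT (Finset.mem_of_mem_erase hv))).resolve_left
      (Finset.ne_of_mem_erase hv))
  -- Otherwise only contact vectors carry weight, and pairing the zero sum with `c - y` kills every
  -- weight. Removing `-u` then lowers `n + 1` to `n`.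
  have hpos : -u ∈ T ∧ 0 < w (-u) := by
    by_contra hcon
    have hz : ∀ v ∈ T, 0 ≤ w v * ⟪v, c - y⟫_ℝ ∧ (w v * ⟪v, c - y⟫_ℝ = 0 → w v = 0) := by
      intro v hv
      rcases (hw v hv).eq_or_lt with h | h
      · simp [← h]
      · have hv' : v ≠ -u := by
          rintro rfl
          exact hcon ⟨hv, h⟩
        have := hcpos v (hF v (Finset.mem_erase.2 ⟨hv', hv⟩))
        exact ⟨by positivity, fun h' => (mul_eq_zero.1 h').resolve_right this.ne'⟩
    have hs : ∑ v ∈ T, w v * ⟪v, c - y⟫_ℝ = 0 := by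
      have := congrArg (fun z => ⟪z, c - y⟫_ℝ) hsum
      simpa [sum_inner, real_inner_smul_left] using this
    rw [Finset.sum_eq_zero_iff_of_nonneg fun v hv => (hz v hv).1] at hs
    rw [Finset.sum_eq_zero fun v hv => (hz v hv).2 (hs v hv)] at hw1
    exact zero_ne_one hw1
  refine ⟨T.erase (-u), fun v => (w (-u))⁻¹ * w v, fun v hv => hF v hv, ?_, fun v hv => ?_, ?_⟩
  · rw [Finset.card_erase_of_mem hpos.1]
    omega
  · exact mul_nonneg (inv_nonneg.2 hpos.2.le) (hw v (Finset.mem_of_mem_erase hv))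
  · rw [← Finset.add_sum_erase T _ hpos.1, smul_neg, neg_add_eq_zero] at hsum
    simp only [mul_smul]
    rw [← Finset.smul_sum, ← hsum, inv_smul_smul₀ hpos.2.ne']

theorem exists_finset_card_le_of_norm_eq_one (hA : IsClosed A) {R : ℝ} (hR0 : 0 ≤ R) (hR : R < 1)
    (hc : ∀ a ∈ A, ‖a - c‖ ≤ R) (hx : x ∈ cHull A) (hy : y ∈ cDual A) (hxy : ‖x - y‖ = 1) :
    ∃ F : Finset (EuclideanSpace ℝ (Fin n)), ↑F ⊆ A ∧ F.card ≤ n ∧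
      x ∈ cHull (F : Set (EuclideanSpace ℝ (Fin n))) := by
  classical
  obtain ⟨F, w, hF, hcard, hw, hsum⟩ := exists_finset_sum_contactVectors hA hR0 hR hc hx hy hxy
  refine ⟨F.image fun v => y + v, ?_, Finset.card_image_le.trans hcard, ?_⟩
  · rw [Finset.coe_image]
    rintro _ ⟨v, hv, rfl⟩
    exact (hF hv).2
  · have := add_mem_cHull_of_sum_eq (y := y) (fun v hv => (hF hv).1) hw hxy hsum
    rwa [add_sub_cancel, ← Finset.coe_image] at this

/-! ### The bound `n + 1` -/

/-- Beyond every point `x` of the `c`-hull, on the ray from `a ∈ A`, there is a point of the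
`c`-hull lying on a unit sphere about a point of the dual. -/
theorem exists_boundary_point (hA' : (cDual A).Nonempty) {a : EuclideanSpace ℝ (Fin n)}
    (ha : a ∈ A) (hx : x ∈ cHull A) (hxa : x ≠ a) :
    ∃ z ∈ cHull A, x ∈ segment ℝ a z ∧ ∃ y ∈ cDual A, ‖z - y‖ = 1 := by
  have hd : 0 < ‖x - a‖ := norm_pos_iff.2 (sub_ne_zero.2 hxa)
  let f : ℝ → EuclideanSpace ℝ (Fin n) := fun t => a + t • (x - a)
  have hf : Continuous f := by fun_prop
  -- Both `f t` and `a` are within 1 of a dual point `y`, whence `t ≤ 2 / ‖x - a‖`.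
  have hcomp : IsCompact (Set.Ici 1 ∩ f ⁻¹' cHull A) := by
    obtain ⟨y, hy⟩ := hA'
    refine (isCompact_Icc (a := (1 : ℝ)) (b := 2 / ‖x - a‖)).of_isClosed_subset
      (isClosed_Ici.inter (isClosed_cDual.preimage hf)) fun t ht => ⟨ht.1, ?_⟩
    have h1 := mem_cHull.1 ht.2 y hy
    have h2 := mem_cDual.1 hy a ha
    have h3 : ‖t • (x - a)‖ ≤ ‖f t - y‖ + ‖a - y‖ := by
      rw [show t • (x - a) = (f t - y) - (a - y) by simp only [f]; abel]
      exact norm_sub_le _ _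
    rw [norm_smul, Real.norm_of_nonneg (zero_le_one.trans ht.1)] at h3
    rw [le_div_iff₀ hd]
    linarith
  obtain ⟨t, ht, hmax⟩ := hcomp.exists_isMaxOn (f := id)
    ⟨1, Set.mem_Ici.2 le_rfl, by simpa [f] using hx⟩ continuousOn_id
  have ht1 : 1 ≤ t := ht.1
  refine ⟨f t, ht.2, ?_, ?_⟩
  · rw [segment_eq_image']
    refine ⟨t⁻¹, ⟨by positivity, inv_le_one_of_one_le₀ ht1⟩, ?_⟩
    simp only [f, add_sub_cancel_left]
    rw [inv_smul_smul₀ (by positivity), add_sub_cancel]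
  · refine (exists_norm_eq_one_or_closedBall_subset ⟨a, ha⟩ hA' ht.2).resolve_right ?_
    rintro ⟨δ, hδ, hball⟩
    have hmem : t + δ / ‖x - a‖ ∈ Set.Ici 1 ∩ f ⁻¹' cHull A := by
      refine ⟨?_, hball ?_⟩
      · have : 0 < δ / ‖x - a‖ := by positivity
        exact Set.mem_Ici.2 (by linarith)
      · rw [Metric.mem_closedBall, dist_eq_norm,
          show f (t + δ / ‖x - a‖) - f t = (δ / ‖x - a‖) • (x - a) by
            simp only [f, add_smul]; abel,
          norm_smul, Real.norm_of_nonneg (by positivity), div_mul_cancel₀ _ hd.ne']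
    have h1 : t + δ / ‖x - a‖ ≤ t := hmax hmem
    have : 0 < δ / ‖x - a‖ := by positivity
    linarith

theorem exists_finset_card_le (hA : IsClosed A) {R : ℝ} (hR0 : 0 ≤ R) (hR : R < 1)
    (hc : ∀ a ∈ A, ‖a - c‖ ≤ R) (hne : A.Nonempty) (hx : x ∈ cHull A) :
    ∃ F : Finset (EuclideanSpace ℝ (Fin n)), ↑F ⊆ A ∧ F.card ≤ n + 1 ∧
      x ∈ cHull (F : Set (EuclideanSpace ℝ (Fin n))) := by
  classical
  obtain ⟨a, ha⟩ := hne
  by_cases hxa : x = a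
  · exact ⟨{a}, by simpa using ha, by simp, subset_cHull (by simp [hxa])⟩
  have hA' : (cDual A).Nonempty := ⟨c, mem_cDual.2 fun b hb => (hc b hb).trans hR.le⟩
  obtain ⟨z, hz, hxz, y, hy, hzy⟩ := exists_boundary_point hA' ha hx hxa
  obtain ⟨F, hF, hcard, hzF⟩ := exists_finset_card_le_of_norm_eq_one hA hR0 hR hc hz hy hzy
  refine ⟨insert a F, ?_, (Finset.card_insert_le _ _).trans (by omega), ?_⟩
  · rw [Finset.coe_insert]
    exact Set.insert_subset ha hF
  · exact convex_cDual.segment_subset (subset_cHull (by simp)) (cHull_mono (by simp) hzF) hxz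

/-! ### Extremal points -/

/-- Split off one vector `b` and normalise the rest `q` to a unit vector: both endpoints lie in `K`
and `x` is in their `c`-hull, so extremality picks one. If it picks `q / ‖q‖`, induction applies
with rescaled weights, hence the quantifier over `w`. -/
theorem mem_of_sum_eq_of_mem_cExt {K : Set (EuclideanSpace ℝ (Fin n))} (hK : cHull K ⊆ K)
    (hx : x ∈ cExt K) (hxy : ‖x - y‖ = 1) (F : Finset (EuclideanSpace ℝ (Fin n))) :
    ∀ w : EuclideanSpace ℝ (Fin n) → ℝ, ↑F ⊆ contactVectors K y → (∀ v ∈ F, 0 ≤ w v) →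
      ∑ v ∈ F, w v • v = x - y → x - y ∈ F := by
  classical
  induction F using Finset.induction_on with
  | empty =>
    intro w _ _ hsum
    rw [Finset.sum_empty] at hsum
    simp [← hsum] at hxy
  | insert b F hb ih =>
    intro w hF hw hsum
    rw [Finset.coe_insert, Set.insert_subset_iff] at hF
    obtain ⟨hbK, hFK⟩ := hF
    rw [Finset.forall_mem_insert] at hw
    obtain ⟨hwb, hw⟩ := hw
    rw [Finset.sum_insert hb] at hsum
    set q := ∑ v ∈ F, w v • v with hq
    by_cases hq0 : q = 0
    · rw [hq0, add_zero] at hsum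
      have h1 : w b = 1 := by
        have := congrArg norm hsum
        rwa [norm_smul, hbK.1, hxy, mul_one, Real.norm_of_nonneg hwb] at this
      rw [← hsum, h1, one_smul]
      exact Finset.mem_insert_self _ _
    have hqpos : 0 < ‖q‖ := norm_pos_iff.2 hq0
    have hq1 : ‖‖q‖⁻¹ • q‖ = 1 := by
      rw [norm_smul, norm_inv, norm_norm, inv_mul_cancel₀ hqpos.ne']
    have hqsum : ∑ v ∈ F, (‖q‖⁻¹ * w v) • v = ‖q‖⁻¹ • q := by
      simp only [mul_smul, ← Finset.smul_sum, hq]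
    have hqw : ∀ v ∈ F, 0 ≤ ‖q‖⁻¹ * w v := fun v hv => mul_nonneg (by positivity) (hw v hv)
    have hqK : y + ‖q‖⁻¹ • q ∈ K := by
      refine hK (cHull_mono ?_ (add_mem_cHull_of_sum_eq (y := y)
        (fun v hv => (hFK hv).1) hqw hq1 hqsum))
      rintro _ ⟨v, hv, rfl⟩
      exact (hFK hv).2
    -- The two directions must differ for the two-element sum below.
    by_cases hbq : ‖q‖⁻¹ • q = b
    · have hsum' : (w b + ‖q‖) • b = x - y := by
        rw [← hsum, add_smul]
        congr 1
        rw [← hbq, smul_inv_smul₀ hqpos.ne']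
      have h1 : w b + ‖q‖ = 1 := by
        have := congrArg norm hsum'
        rwa [norm_smul, hbK.1, hxy, mul_one, Real.norm_of_nonneg (by positivity)] at this
      rw [← hsum', h1, one_smul]
      exact Finset.mem_insert_self _ _
    have hxmem : x ∈ cHull {y + b, y + ‖q‖⁻¹ • q} := by
      have := add_mem_cHull_of_sum_eq (y := y) (u := x - y) (F := {b, ‖q‖⁻¹ • q})
        (w := fun v => if v = b then w b else ‖q‖) ?_ ?_ hxy ?_
      · simpa [Set.image_pair] using this
      · simp [hbK.1, hq1]
      · intro v _
        split_ifs <;> positivity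
      · rw [Finset.sum_pair (Ne.symm hbq), if_pos rfl, if_neg hbq, smul_inv_smul₀ hqpos.ne', hsum]
    rcases hx.2 _ hbK.2 _ hqK hxmem with h | h
    · rw [← h, add_sub_cancel_left]
      exact Finset.mem_insert_self _ _
    · refine Finset.mem_insert_of_mem (ih _ hFK hqw ?_)
      rw [hqsum, ← h, add_sub_cancel_left]

/-- An interior point is the midpoint of `x + v` and `x - v`; positive dimension supplies `v ≠ 0`.
-/
theorem not_closedBall_subset_of_mem_cExt [NeZero n] {K : Set (EuclideanSpace ℝ (Fin n))}
    (hx : x ∈ cExt K) {δ : ℝ} (hδ : 0 < δ) : ¬ Metric.closedBall x δ ⊆ K := by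
  intro h
  obtain ⟨v, hv⟩ := exists_norm_eq (EuclideanSpace ℝ (Fin n)) hδ.le
  have hv0 : v ≠ 0 := norm_pos_iff.1 (hv ▸ hδ)
  have hmem : x ∈ cHull {x + v, x - v} := by
    have hseg : x ∈ segment ℝ (x + v) (x - v) :=
      ⟨1 / 2, 1 / 2, by norm_num, by norm_num, by norm_num, by module⟩
    exact convex_cDual.segment_subset (subset_cHull (Set.mem_insert _ _))
      (subset_cHull (Set.mem_insert_of_mem _ (Set.mem_singleton _))) hseg
  rcases hx.2 (x + v) (h (by simp [hv])) (x - v) (h (by simp [hv])) hmem with h | h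
  · exact hv0 (by simpa using h)
  · exact hv0 (by simpa using h)

theorem cExt_cHull_subset [NeZero n] (hA : IsClosed A) {R : ℝ} (hR0 : 0 ≤ R) (hR : R < 1)
    (hc : ∀ a ∈ A, ‖a - c‖ ≤ R) (hne : A.Nonempty) : cExt (cHull A) ⊆ A := by
  intro x hx
  have hA' : (cDual A).Nonempty := ⟨c, mem_cDual.2 fun b hb => (hc b hb).trans hR.le⟩
  rcases exists_norm_eq_one_or_closedBall_subset hne hA' hx.1 with ⟨y, hy, hxy⟩ | ⟨δ, hδ, hball⟩
  · obtain ⟨F, w, hF, -, hw, hsum⟩ := exists_finset_sum_contactVectors hA hR0 hR hc hx.1 hy hxy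
    have := mem_of_sum_eq_of_mem_cExt (cHull_subset subset_rfl) hx hxy F w
      (fun v hv => ⟨(hF hv).1, subset_cHull (hF hv).2⟩) hw hsum
    simpa using (hF this).2
  · exact absurd hball (not_closedBall_subset_of_mem_cExt hx hδ)

theorem cHull_empty [NeZero n] : cHull (∅ : Set (EuclideanSpace ℝ (Fin n))) = ∅ := by
  refine Set.eq_empty_iff_forall_notMem.2 fun x hx => ?_
  obtain ⟨v, hv⟩ := exists_norm_eq (EuclideanSpace ℝ (Fin n)) zero_le_two
  have := mem_cHull.1 hx (x - v) (mem_cDual.2 (by simp))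
  rw [sub_sub_cancel, hv] at this
  norm_num at this

end BallBody

theorem mainTheorem3 (n : ℕ) (hn : 2 ≤ n) (A : Set (EuclideanSpace ℝ (Fin n)))
    (hA : IsClosed A) (hR : BallBody.outrad A < 1) :
    (∀ x ∈ BallBody.cHull A, ∃ m : ℕ, m ≤ n + 1 ∧ ∃ p : Fin m → EuclideanSpace ℝ (Fin n),
      (∀ i, p i ∈ A) ∧ x ∈ BallBody.cHull (Set.range p)) ∧
    BallBody.cExt (BallBody.cHull A) ⊆ A := by
  have : NeZero n := ⟨by omega⟩
  obtain ⟨c, R, hR0, hR1, hc⟩ := BallBody.exists_center_of_outrad_lt_one hR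
  rcases A.eq_empty_or_nonempty with rfl | hne
  · rw [BallBody.cHull_empty]
    exact ⟨fun x hx => hx.elim, fun x hx => hx.1⟩
  refine ⟨fun x hx => ?_, BallBody.cExt_cHull_subset hA hR0 hR1 hc hne⟩
  obtain ⟨F, hF, hcard, hxF⟩ := BallBody.exists_finset_card_le hA hR0 hR1 hc hne hx
  refine ⟨F.card, hcard, fun i => F.equivFin.symm i, fun i => hF (F.equivFin.symm i).2, ?_⟩
  convert hxF
  ext v
  exact ⟨fun ⟨i, hi⟩ => hi ▸ (F.equivFin.symm i).2, fun hv => ⟨F.equivFin ⟨v, hv⟩, by simp⟩⟩
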